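/- **Theorem (full convergence of the rank-1 Cadzow iteration).** Let $2\le M\le N$ and let $A\in\mathbb C^{M\times N}$ have rank at least $1$. For $B=(b_{k,\ell})_{k,\ell=0}^{M-1,N-1}\in\mathbb C^{M\times N}$ let $P(B)$ be the Hankel matrix obtained by averaging $B$ along its counter diagonals, i.e. $P(B)_{k,\ell}$ is the arithmetic mean of all entries $b_{r,s}$ with $0\le r\le M-1$, $0\le s\le N-1$ and $r+s=k+\ell$. Let $\sigma_0$ be the largest singular value of $A$ and $u_0\in\mathbb C^M$, $v_0\in\mathbb C^N$ corresponding normalized left and right singular vectors, and for $j\ge 0$ let $\sigma_{j+1}$ be the largest singular value of $P(\sigma_j u_j v_j^*)$ and $u_{j+1},v_{j+1}$ corresponding normalized left and right singular vectors (if these are not unique, any choice is allowed). For $n\in\mathbb N$ and $z\in\mathbb C$ put $\mathbf z_n=\mathbf z_n(z)=\bigl(\sum_{k=0}^{n-1}|z|^{2k}\bigr)^{-1/2}(1,z,\dots,z^{n-1})^T$ and $\mathbf e_n=(0,\dots,0,1)^T\in\mathbb C^n$. Then the sequence $(\sigma_j)_{j\ge0}$ converges to some $\sigma\ge 0$. If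 $\sigma=0$, then $\lim_{j\to\infty}\sigma_j u_jv_j^*=0$. If $\sigma>0$, then the whole sequence $(u_jv_j^*)_{j\ge 0}$ converges, and there is $c\in\mathbb C$ with $|c|=1$ such that its limit $H$ satisfies either $H=c\,\mathbf z_M(z)\,\mathbf z_N(z)^T$ for some $z\in\mathbb C$, or $H=c\,\mathbf e_M\mathbf e_N^T$. Consequently $\sigma_ju_jv_j^*$ converges to $\sigma H$, which is a Hankel matrix of rank $1$. -/

import Mathlib

open Filter Topology

namespace Cadzow

/-- `H = (h_{k+l})`: the entries of `H` depend only on the sum of the (zero-based) indices. -/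
def IsHankel {M N : ℕ} (H : Matrix (Fin M) (Fin N) ℂ) : Prop :=
  ∃ h : ℕ → ℂ, ∀ k l, H k l = h ((k : ℕ) + (l : ℕ))

/-- The positions `(r, s)` of an `M × N` matrix on the counter diagonal `r + s = d`. -/
def counterDiagonal (M N d : ℕ) : Finset (Fin M × Fin N) :=
  Finset.univ.filter fun p => (p.1 : ℕ) + (p.2 : ℕ) = d

/-- The projection `P` onto the Hankel matrices: average the entries along each counter diagonal. -/
noncomputable def hankelProj {M N : ℕ} (A : Matrix (Fin M) (Fin N) ℂ) :
    Matrix (Fin M) (Fin N) ℂ :=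
  Matrix.of fun k l =>
    (∑ p ∈ counterDiagonal M N ((k : ℕ) + (l : ℕ)), A p.1 p.2) /
      ((counterDiagonal M N ((k : ℕ) + (l : ℕ))).card : ℂ)

/-- The matrix `u v^*`. -/
noncomputable def outer {M N : ℕ} (u : EuclideanSpace ℂ (Fin M)) (v : EuclideanSpace ℂ (Fin N)) :
    Matrix (Fin M) (Fin N) ℂ :=
  Matrix.of fun k l => u k * starRingEnd ℂ (v l)

/-- `s` is the largest singular value of `A`, and `u`, `v` are corresponding normalized left and
right singular vectors. -/
structure IsLeadingSingularTriple {M N : ℕ} (A : Matrix (Fin M) (Fin N) ℂ) (s : ℝ)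
    (u : EuclideanSpace ℂ (Fin M)) (v : EuclideanSpace ℂ (Fin N)) : Prop where
  value_eq : s = (Matrix.toEuclideanLin A).singularValues 0
  norm_left : ‖u‖ = 1
  norm_right : ‖v‖ = 1
  map_right : Matrix.toEuclideanLin A v = (s : ℂ) • u
  map_left : Matrix.toEuclideanLin A.conjTranspose u = (s : ℂ) • v

/-- `(σ_j, u_j, v_j)` is produced by the rank-1 Cadzow iteration started at `A`. If a largest
singular value is not simple, any choice of its singular vectors is admitted. -/
structure IsCadzowIteration {M N : ℕ} (A : Matrix (Fin M) (Fin N) ℂ) (σ : ℕ → ℝ)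
    (u : ℕ → EuclideanSpace ℂ (Fin M)) (v : ℕ → EuclideanSpace ℂ (Fin N)) : Prop where
  start : IsLeadingSingularTriple A (σ 0) (u 0) (v 0)
  step : ∀ j : ℕ, IsLeadingSingularTriple (hankelProj ((σ j : ℂ) • outer (u j) (v j)))
    (σ (j + 1)) (u (j + 1)) (v (j + 1))

/-- The normalized vector `(1, z, ..., z^(N-1))`. -/
noncomputable def zVec (N : ℕ) (z : ℂ) : Fin N → ℂ := fun k =>
  (((Real.sqrt (∑ i ∈ Finset.range N, ‖z‖ ^ (2 * i)))⁻¹ : ℝ) : ℂ) * z ^ (k : ℕ)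

/-- The last standard basis vector `(0, ..., 0, 1)`. -/
def eVec (N : ℕ) : Fin N → ℂ := fun k => if (k : ℕ) + 1 = N then 1 else 0

end Cadzow

/-!
Write `X_j = σ_j u_j v_j^*`, `Y_j = P X_j`, and let `S` be the set of Hankel matrices of rank at
most one. In the Frobenius norm, `P` is an orthogonal projection and `Y_j - X_{j+1}` is orthogonal to
`X_{j+1}`, hence
`σ_j^2 = σ_{j+1}^2 + ‖X_j - Y_j‖^2 + ‖Y_j - X_{j+1}‖^2` (`IsCadzowIteration.sq_eq`). So `σ_j`
decreases to a limit `s ≥ 0` and both losses tend to zero. This alone does not make the steps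
summable. For `s > 0`, two facts show that the distance of `X_j` to `S` decays geometrically.

* Error bound (`exists_geometricHankel_near`): for a rank-one matrix `X` the distance to `S` is at
  most `C` times the distance to the space of all Hankel matrices, with `C` depending only on the
  size. If `a_k w_l` depends on `k + l` only, up to `δ`, then all consecutive pairs of entries of
  `a` are nearly parallel to one pair `(w_l, w_{l+1})` containing a largest entry of `w`. The ratio of
  that pair makes the common values on the counter diagonals nearly geometric.
* Truncation (`IsLeadingSingularTriple.norm_smul_outer_sub_sq_le`): `Y_j - X_{j+1}` is normal to the
  rank-one matrices at `X_{j+1}`, so its inner product with any rank-one matrix `W` is of second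
  order in `‖X_{j+1} - W‖`, with a factor `‖Y_j - X_{j+1}‖ / σ_{j+1} → 0`.

For `W ∈ S`, Pythagoras gives `‖Y_j - W‖^2 = ‖X_j - W‖^2 - ‖X_j - Y_j‖^2`. By the error bound the
subtracted term is a fixed proportion of the squared distance to `S`, and by the second fact the
passage to `X_{j+1}` costs a factor tending to one. Hence the distances to `S` contract, they bound
the steps, and `X_j` is a Cauchy sequence (`IsCadzowIteration.exists_tendsto_entries`). The limit of
`u_j v_j^*` is a Hankel matrix of rank one and norm one, so the error bound, now with
right-hand side zero, places it in `S`. There the matrices `(c z^(k+l))`, and those obtained from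
them by reversing rows and columns, have the normalized form claimed
(`normal_form_of_mem_geometricHankel`).
-/

namespace Cadzow

variable {M N : ℕ}

/-! ### Rank-one matrices in the Frobenius inner product -/

/-- The entries of a matrix as a vector of the Euclidean space on the index pairs; its norm is the
Frobenius norm of the matrix. -/
noncomputable def entries :
    Matrix (Fin M) (Fin N) ℂ →ₗ[ℂ] EuclideanSpace ℂ (Fin M × Fin N) where
  toFun A := WithLp.toLp 2 fun p => A p.1 p.2
  map_add' _ _ := rfl
  map_smul' _ _ := rfl

@[simp]
theorem entries_apply (A : Matrix (Fin M) (Fin N) ℂ) (p : Fin M × Fin N) :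
    entries A p = A p.1 p.2 := rfl

theorem inner_entries_outer (B : Matrix (Fin M) (Fin N) ℂ) (a : EuclideanSpace ℂ (Fin M))
    (b : EuclideanSpace ℂ (Fin N)) :
    inner ℂ (entries (outer a b)) (entries B) = inner ℂ a (Matrix.toEuclideanLin B b) := by
  simp only [PiLp.inner_apply, entries_apply, outer, Matrix.of_apply, RCLike.inner_apply,
    Matrix.ofLp_toLpLin, Matrix.toLin'_apply, Matrix.mulVec, dotProduct, map_mul, Complex.conj_conj,
    Fintype.sum_prod_type, Finset.sum_mul]
  refine Finset.sum_congr rfl fun k _ => Finset.sum_congr rfl fun l _ => ?_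
  ring

theorem toEuclideanLin_outer (a : EuclideanSpace ℂ (Fin M)) (b c : EuclideanSpace ℂ (Fin N)) :
    Matrix.toEuclideanLin (outer a b) c = inner ℂ b c • a := by
  ext k
  simp only [Matrix.ofLp_toLpLin, Matrix.toLin'_apply, Matrix.mulVec, dotProduct, outer,
    Matrix.of_apply, PiLp.smul_apply, PiLp.inner_apply, RCLike.inner_apply, smul_eq_mul,
    Finset.sum_mul]
  refine Finset.sum_congr rfl fun l _ => ?_
  ring

theorem outer_conjTranspose (a : EuclideanSpace ℂ (Fin M)) (b : EuclideanSpace ℂ (Fin N)) :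
    (outer a b).conjTranspose = outer b a := by
  ext k l
  simp [outer, Matrix.conjTranspose_apply, mul_comm]

theorem inner_outer_outer (a c : EuclideanSpace ℂ (Fin M)) (b d : EuclideanSpace ℂ (Fin N)) :
    inner ℂ (entries (outer a b)) (entries (outer c d)) = inner ℂ a c * inner ℂ d b := by
  rw [inner_entries_outer, toEuclideanLin_outer, inner_smul_right, mul_comm]

theorem norm_entries_outer (a : EuclideanSpace ℂ (Fin M)) (b : EuclideanSpace ℂ (Fin N)) :
    ‖entries (outer a b)‖ = ‖a‖ * ‖b‖ := by
  have h : (‖entries (outer a b)‖ : ℂ) ^ 2 = ((‖a‖ * ‖b‖ : ℝ) : ℂ) ^ 2 := by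
    have := inner_outer_outer a a b b
    rw [inner_self_eq_norm_sq_to_K, inner_self_eq_norm_sq_to_K, inner_self_eq_norm_sq_to_K] at this
    push_cast
    rw [mul_pow]
    exact this
  have h' : ‖entries (outer a b)‖ ^ 2 = (‖a‖ * ‖b‖) ^ 2 := by exact_mod_cast h
  exact (sq_eq_sq₀ (norm_nonneg _) (by positivity)).1 h'

theorem inner_toEuclideanLin (B : Matrix (Fin M) (Fin N) ℂ) (a : EuclideanSpace ℂ (Fin M))
    (b : EuclideanSpace ℂ (Fin N)) :
    inner ℂ a (Matrix.toEuclideanLin B b)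
      = inner ℂ (Matrix.toEuclideanLin B.conjTranspose a) b := by
  rw [Matrix.toEuclideanLin_conjTranspose_eq_adjoint, LinearMap.adjoint_inner_left]

/-! ### The projection onto the Hankel matrices -/

theorem hankelProj_isHankel (B : Matrix (Fin M) (Fin N) ℂ) : IsHankel (hankelProj B) :=
  ⟨fun d => (∑ p ∈ counterDiagonal M N d, B p.1 p.2) / ((counterDiagonal M N d).card : ℂ),
    fun _ _ => rfl⟩

/-- The averaging map is the orthogonal projection onto the Hankel matrices: what it removes has
sum zero on every counter diagonal. -/
theorem inner_sub_hankelProj {H : Matrix (Fin M) (Fin N) ℂ} (hH : IsHankel H)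
    (B : Matrix (Fin M) (Fin N) ℂ) : inner ℂ (entries H) (entries (B - hankelProj B)) = 0 := by
  obtain ⟨h, hh⟩ := hH
  simp only [PiLp.inner_apply, entries_apply, RCLike.inner_apply, hh]
  rw [← Finset.sum_fiberwise_of_maps_to (s := Finset.univ) (t := Finset.range (M + N))
    (g := fun p : Fin M × Fin N => (p.1 : ℕ) + (p.2 : ℕ))
    (fun p _ => by simp only [Finset.mem_range]; omega)]
  refine Finset.sum_eq_zero fun d _ => ?_
  change ∑ p ∈ counterDiagonal M N d, _ = 0
  have hd : ∀ p ∈ counterDiagonal M N d, (p.1 : ℕ) + (p.2 : ℕ) = d := fun p hp =>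
    (Finset.mem_filter.1 hp).2
  rw [Finset.sum_congr rfl (g := fun p => (B p.1 p.2 - (∑ q ∈ counterDiagonal M N d, B q.1 q.2) /
    ((counterDiagonal M N d).card : ℂ)) * starRingEnd ℂ (h d)) fun p hp => by
      simp only [Matrix.sub_apply, hankelProj, Matrix.of_apply, hd p hp]]
  rw [← Finset.sum_mul, Finset.sum_sub_distrib, Finset.sum_const, nsmul_eq_mul]
  rcases (counterDiagonal M N d).eq_empty_or_nonempty with he | hne
  · simp [he]
  · rw [mul_div_cancel₀ _ (by exact_mod_cast hne.card_pos.ne'), sub_self, zero_mul]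

/-- Pythagoras for the projection onto the Hankel matrices. -/
theorem norm_sub_sq_of_isHankel {H : Matrix (Fin M) (Fin N) ℂ} (hH : IsHankel H)
    (B : Matrix (Fin M) (Fin N) ℂ) :
    ‖entries B - entries H‖ ^ 2
      = ‖entries B - entries (hankelProj B)‖ ^ 2 + ‖entries (hankelProj B) - entries H‖ ^ 2 := by
  have h1 := inner_sub_hankelProj hH B
  have h2 := inner_sub_hankelProj (hankelProj_isHankel B) B
  have h3 : inner ℂ (entries (hankelProj B) - entries H) (entries B - entries (hankelProj B))
      = 0 := by
    rw [← map_sub entries B, inner_sub_left, h1, h2, sub_zero]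
  have h4 := norm_add_sq_eq_norm_sq_add_norm_sq_of_inner_eq_zero _ _ h3
  rw [add_comm (entries (hankelProj B) - entries H), sub_add_sub_cancel] at h4
  linarith

/-! ### Truncation to rank one -/

/-- If `u v^*` is a unit matrix and `E` annihilates `v` and `u` on the respective sides, then `E`
is orthogonal to the tangent space at `u v^*` of the set of matrices of rank one, so it pairs with
a rank-one matrix only to second order in the distance. -/
theorem norm_inner_le_of_normal {E : Matrix (Fin M) (Fin N) ℂ} {u : EuclideanSpace ℂ (Fin M)}
    {v : EuclideanSpace ℂ (Fin N)} (hu : ‖u‖ = 1) (hv : ‖v‖ = 1)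
    (hEv : Matrix.toEuclideanLin E v = 0) (hEu : Matrix.toEuclideanLin E.conjTranspose u = 0)
    (a : EuclideanSpace ℂ (Fin M)) (b : EuclideanSpace ℂ (Fin N)) {s : ℝ} (hs : 0 ≤ s) :
    s * ‖inner ℂ (entries (outer a b)) (entries E)‖ ≤
      2 * ‖entries E‖ * ‖entries ((s : ℂ) • outer u v) - entries (outer a b)‖ ^ 2 := by
  set a' := a - inner ℂ u a • u with ha'
  set b' := b - inner ℂ v b • v with hb'
  set D := ‖entries ((s : ℂ) • outer u v) - entries (outer a b)‖ with hD
  have huu : inner ℂ u u = 1 := by rw [inner_self_eq_norm_sq_to_K, hu]; simp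
  have hvv : inner ℂ v v = 1 := by rw [inner_self_eq_norm_sq_to_K, hv]; simp
  have hau : inner ℂ a' u = 0 := by
    rw [ha', inner_sub_left, inner_smul_left, huu, inner_conj_symm, mul_one, sub_self]
  have hbv : inner ℂ v b' = 0 := by
    rw [hb', inner_sub_right, inner_smul_right, hvv, mul_one, sub_self]
  have haa : inner ℂ a' a = inner ℂ a' a' := by
    conv_rhs => rw [ha', inner_sub_right, ← ha', inner_smul_right, hau, mul_zero, sub_zero]
  -- Only the components `a'`, `b'` orthogonal to `u`, `v` are seen by `E`.
  have hE : inner ℂ (entries (outer a b)) (entries E)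
      = inner ℂ (entries (outer a' b')) (entries E) := by
    have h1 : Matrix.toEuclideanLin E b' = Matrix.toEuclideanLin E b := by
      rw [hb', map_sub, map_smul, hEv, smul_zero, sub_zero]
    rw [inner_entries_outer, inner_entries_outer, h1, ha', inner_sub_left, inner_smul_left,
      inner_toEuclideanLin E u, hEu, inner_zero_left, mul_zero, sub_zero]
  have hEle : ‖inner ℂ (entries (outer a b)) (entries E)‖ ≤ ‖a'‖ * ‖b'‖ * ‖entries E‖ := by
    rw [hE, ← norm_entries_outer]
    exact norm_inner_le_norm _ _
  have hbb : inner ℂ b b' = inner ℂ b' b' := by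
    conv_rhs => rw [hb', inner_sub_left, ← hb', inner_smul_left, hbv, mul_zero, sub_zero]
  have hnorm : ∀ {x : ℝ} {y : ℝ}, 0 ≤ x → x ^ 2 ≤ x * y → 0 ≤ y → x ≤ y := by
    intro x y hx hxy hy
    by_contra! h
    nlinarith
  have key1 : ‖a'‖ * ‖b‖ ≤ D := by
    refine hnorm (by positivity) ?_ (norm_nonneg _)
    have h1 := norm_inner_le_norm (𝕜 := ℂ) (entries (outer a' b))
      (entries ((s : ℂ) • outer u v) - entries (outer a b))
    rw [inner_sub_right, map_smul, inner_smul_right, inner_outer_outer, inner_outer_outer, hau, haa,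
      zero_mul, mul_zero, zero_sub, norm_neg, inner_self_eq_norm_sq_to_K,
      inner_self_eq_norm_sq_to_K, norm_entries_outer, norm_mul, norm_pow, norm_pow,
      RCLike.norm_ofReal, RCLike.norm_ofReal, abs_norm, abs_norm, ← mul_pow, ← map_smul] at h1
    exact h1
  have key2 : ‖a‖ * ‖b'‖ ≤ D := by
    refine hnorm (by positivity) ?_ (norm_nonneg _)
    have h1 := norm_inner_le_norm (𝕜 := ℂ) (entries (outer a b'))
      (entries ((s : ℂ) • outer u v) - entries (outer a b))
    rw [inner_sub_right, map_smul, inner_smul_right, inner_outer_outer, inner_outer_outer, hbv, hbb,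
      mul_zero, mul_zero, zero_sub, norm_neg, inner_self_eq_norm_sq_to_K,
      inner_self_eq_norm_sq_to_K, norm_entries_outer, norm_mul, norm_pow, norm_pow,
      RCLike.norm_ofReal, RCLike.norm_ofReal, abs_norm, abs_norm, ← mul_pow, ← map_smul] at h1
    exact h1
  have hb'b : ‖b'‖ ≤ ‖b‖ := by
    refine hnorm (norm_nonneg _) ?_ (norm_nonneg _)
    have h1 := norm_inner_le_norm (𝕜 := ℂ) b b'
    rw [hbb, inner_self_eq_norm_sq_to_K, norm_pow, RCLike.norm_ofReal, abs_norm] at h1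
    linarith
  have hsle : s ≤ ‖a‖ * ‖b‖ + D := by
    have h1 : ‖entries ((s : ℂ) • outer u v)‖ = s := by
      rw [map_smul, norm_smul, norm_entries_outer, hu, hv, Complex.norm_real, Real.norm_eq_abs,
        abs_of_nonneg hs, mul_one, mul_one]
    have h2 := norm_sub_norm_le (entries ((s : ℂ) • outer u v)) (entries (outer a b))
    rw [h1, norm_entries_outer] at h2
    linarith
  have hD0 : 0 ≤ D := norm_nonneg _
  have h3 : s * (‖a'‖ * ‖b'‖) ≤ 2 * D ^ 2 := by
    have e1 : ‖a'‖ * ‖b'‖ ≤ D := (mul_le_mul_of_nonneg_left hb'b (norm_nonneg _)).trans key1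
    have e2 : (‖a'‖ * ‖b‖) * (‖a‖ * ‖b'‖) ≤ D * D :=
      mul_le_mul key1 key2 (by positivity) hD0
    calc s * (‖a'‖ * ‖b'‖) ≤ (‖a‖ * ‖b‖ + D) * (‖a'‖ * ‖b'‖) :=
          mul_le_mul_of_nonneg_right hsle (by positivity)
      _ = (‖a'‖ * ‖b‖) * (‖a‖ * ‖b'‖) + D * (‖a'‖ * ‖b'‖) := by ring
      _ ≤ D * D + D * D := add_le_add e2 (mul_le_mul_of_nonneg_left e1 hD0)
      _ = 2 * D ^ 2 := by ring
  calc s * ‖inner ℂ (entries (outer a b)) (entries E)‖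
      ≤ s * (‖a'‖ * ‖b'‖ * ‖entries E‖) := mul_le_mul_of_nonneg_left hEle hs
    _ = ‖entries E‖ * (s * (‖a'‖ * ‖b'‖)) := by ring
    _ ≤ ‖entries E‖ * (2 * D ^ 2) := mul_le_mul_of_nonneg_left h3 (norm_nonneg _)
    _ = _ := by ring

namespace IsLeadingSingularTriple

variable {B : Matrix (Fin M) (Fin N) ℂ} {s : ℝ} {u : EuclideanSpace ℂ (Fin M)}
  {v : EuclideanSpace ℂ (Fin N)}

theorem nonneg (h : IsLeadingSingularTriple B s u v) : 0 ≤ s :=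
  h.value_eq ▸ LinearMap.singularValues_nonneg _ _

theorem norm_entries_smul_outer (h : IsLeadingSingularTriple B s u v) :
    ‖entries ((s : ℂ) • outer u v)‖ = s := by
  rw [map_smul, norm_smul, norm_entries_outer, h.norm_left, h.norm_right, Complex.norm_real,
    Real.norm_of_nonneg h.nonneg, mul_one, mul_one]

theorem toEuclideanLin_sub (h : IsLeadingSingularTriple B s u v) :
    Matrix.toEuclideanLin (B - (s : ℂ) • outer u v) v = 0 := by
  rw [map_sub, LinearMap.sub_apply, h.map_right, map_smul, LinearMap.smul_apply,
    toEuclideanLin_outer, inner_self_eq_norm_sq_to_K, h.norm_right]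
  simp

theorem toEuclideanLin_conjTranspose_sub (h : IsLeadingSingularTriple B s u v) :
    Matrix.toEuclideanLin (B - (s : ℂ) • outer u v).conjTranspose u = 0 := by
  rw [Matrix.conjTranspose_sub, map_sub, LinearMap.sub_apply, h.map_left,
    Matrix.conjTranspose_smul, outer_conjTranspose, map_smul, LinearMap.smul_apply,
    toEuclideanLin_outer, inner_self_eq_norm_sq_to_K, h.norm_left]
  simp

theorem inner_smul_outer_sub (h : IsLeadingSingularTriple B s u v) :
    inner ℂ (entries ((s : ℂ) • outer u v)) (entries (B - (s : ℂ) • outer u v)) = 0 := by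
  rw [map_smul, inner_smul_left, inner_entries_outer, h.toEuclideanLin_sub, inner_zero_right,
    mul_zero]

theorem norm_entries_sq (h : IsLeadingSingularTriple B s u v) :
    ‖entries B‖ ^ 2 = s ^ 2 + ‖entries B - entries ((s : ℂ) • outer u v)‖ ^ 2 := by
  have h1 := norm_add_sq_eq_norm_sq_add_norm_sq_of_inner_eq_zero _ _ h.inner_smul_outer_sub
  rw [← map_add, add_sub_cancel, h.norm_entries_smul_outer, map_sub] at h1
  linarith

/-- If `u`, `v` are singular vectors of `B` for `s`, then passing from `B` to `s u v^*` does not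
increase the distance to a rank-one matrix by more than a factor that tends to one as
`‖B - s u v^*‖ → 0`. -/
theorem norm_smul_outer_sub_sq_le (h : IsLeadingSingularTriple B s u v) (hs : 0 < s)
    (a : EuclideanSpace ℂ (Fin M)) (b : EuclideanSpace ℂ (Fin N)) :
    (1 - 4 * ‖entries B - entries ((s : ℂ) • outer u v)‖ / s) *
        ‖entries ((s : ℂ) • outer u v) - entries (outer a b)‖ ^ 2
      ≤ ‖entries B - entries (outer a b)‖ ^ 2 := by
  have h1 := norm_inner_le_of_normal h.norm_left h.norm_right h.toEuclideanLin_sub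
    h.toEuclideanLin_conjTranspose_sub a b hs.le
  have hEX := h.inner_smul_outer_sub
  set X := (s : ℂ) • outer u v with hX
  set D := ‖entries X - entries (outer a b)‖
  have h2 : ‖entries B - entries (outer a b)‖ ^ 2 = D ^ 2
      + 2 * RCLike.re (inner ℂ (entries X - entries (outer a b)) (entries (B - X)))
      + ‖entries (B - X)‖ ^ 2 := by
    rw [← norm_add_sq (𝕜 := ℂ), map_sub, add_comm, sub_add_sub_cancel]
  rw [inner_sub_left, hEX, zero_sub, map_neg] at h2
  have h3 := RCLike.re_le_norm (inner ℂ (entries (outer a b)) (entries (B - X)))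
  rw [← map_sub]
  have h4 : ‖inner ℂ (entries (outer a b)) (entries (B - X))‖ ≤
      2 * ‖entries (B - X)‖ / s * D ^ 2 := by
    rw [div_mul_eq_mul_div, le_div_iff₀ hs]
    linarith
  have h5 : 4 * ‖entries (B - X)‖ / s * D ^ 2 = 2 * (2 * ‖entries (B - X)‖ / s * D ^ 2) := by ring
  rw [h2, sub_mul, h5]
  linarith [sq_nonneg ‖entries (B - X)‖]

end IsLeadingSingularTriple

/-! ### Hankel matrices of rank one and the error bound -/

/-- The Hankel matrices `(c z^(k+l))` together with their images under reversal of the rows and the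
columns, as vectors of entries. For sizes at least two these are all the Hankel matrices of rank at
most one; the reversed family contains the multiples of the matrix whose only nonzero entry is the
last one. -/
def geometricHankel (M N : ℕ) : Set (EuclideanSpace ℂ (Fin M × Fin N)) :=
  {x | ∃ c z : ℂ, (∀ p, x p = c * z ^ ((p.1 : ℕ) + (p.2 : ℕ))) ∨
    ∀ p, x p = c * z ^ ((p.1.rev : ℕ) + (p.2.rev : ℕ))}

theorem zero_mem_geometricHankel : (0 : EuclideanSpace ℂ (Fin M × Fin N)) ∈ geometricHankel M N :=
  ⟨0, 0, Or.inl fun p => by simp⟩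

theorem smul_mem_geometricHankel {x : EuclideanSpace ℂ (Fin M × Fin N)}
    (hx : x ∈ geometricHankel M N) (t : ℂ) : t • x ∈ geometricHankel M N := by
  obtain ⟨c, z, h | h⟩ := hx
  · exact ⟨t * c, z, Or.inl fun p => by rw [PiLp.smul_apply, h, smul_eq_mul, mul_assoc]⟩
  · exact ⟨t * c, z, Or.inr fun p => by rw [PiLp.smul_apply, h, smul_eq_mul, mul_assoc]⟩

theorem exists_outer_of_mem_geometricHankel {x : EuclideanSpace ℂ (Fin M × Fin N)}
    (hx : x ∈ geometricHankel M N) :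
    ∃ a b, x = entries (outer a b) ∧ IsHankel (outer (M := M) (N := N) a b) := by
  obtain ⟨c, z, h | h⟩ := hx
  · have e : ∀ (k : Fin M) (l : Fin N), outer (WithLp.toLp 2 fun k : Fin M => c * z ^ (k : ℕ))
        (WithLp.toLp 2 fun l : Fin N => starRingEnd ℂ (z ^ (l : ℕ))) k l
        = c * z ^ ((k : ℕ) + (l : ℕ)) := by
      intro k l
      simp only [outer, Matrix.of_apply, Complex.conj_conj]
      ring
    exact ⟨_, _, by ext p; rw [h, entries_apply, e], fun d => c * z ^ d, e⟩
  · have e : ∀ (k : Fin M) (l : Fin N),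
        outer (WithLp.toLp 2 fun k : Fin M => c * z ^ (k.rev : ℕ))
        (WithLp.toLp 2 fun l : Fin N => starRingEnd ℂ (z ^ (l.rev : ℕ))) k l
        = c * z ^ ((k.rev : ℕ) + (l.rev : ℕ)) := by
      intro k l
      simp only [outer, Matrix.of_apply, Complex.conj_conj]
      ring
    refine ⟨_, _, by ext p; rw [h, entries_apply, e], fun d => c * z ^ (M + N - 2 - d), ?_⟩
    intro k l
    rw [e, Fin.val_rev, Fin.val_rev]
    congr 2
    omega

/-- If the products `a k * w l` agree with the entries `h (k + l)` up to `δ` and `w` has two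
consecutive entries, the first of which is not too small and dominates the second, then `h` is a
geometric sequence up to a multiple of `δ`: the ratio `z` of these two entries is at the same time
an approximate ratio of consecutive entries of `a`. -/
theorem exists_geometric_approx (hM : 2 ≤ M) {a : Fin M → ℂ} {w : Fin N → ℂ} {h : ℕ → ℂ} {δ κ : ℝ}
    (hδ : ∀ k l, ‖a k * w l - h ((k : ℕ) + (l : ℕ))‖ ≤ δ) (hw : ∀ l, ‖w l‖ ≤ 1)
    {l₀ l₁ : Fin N} (hl : (l₁ : ℕ) = l₀ + 1) (hle : ‖w l₁‖ ≤ ‖w l₀‖) (hκ : 1 ≤ κ * ‖w l₀‖)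
    (hκ0 : 0 ≤ κ) :
    ∃ z : ℂ, ∀ k l, ‖a k * w l - h 0 * z ^ ((k : ℕ) + (l : ℕ))‖ ≤
      (1 + (M + N) * (2 + 2 * κ)) * δ := by
  have hpos : 0 < ‖w l₀‖ := by
    by_contra! h0
    nlinarith [norm_nonneg (w l₀)]
  have hw0 : w l₀ ≠ 0 := norm_pos_iff.1 hpos
  have hδ0 : 0 ≤ δ := (norm_nonneg _).trans (hδ ⟨0, by omega⟩ l₀)
  set z := w l₁ / w l₀ with hz
  have hz1 : ‖z‖ ≤ 1 := by rw [hz, norm_div]; exact div_le_one_of_le₀ hle hpos.le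
  have ha : ∀ k k' : Fin M, (k' : ℕ) = k + 1 → ‖a k' - z * a k‖ ≤ 2 * κ * δ := by
    intro k k' hk
    have e1 : (a k' - z * a k) * w l₀
        = (a k' * w l₀ - h ((k' : ℕ) + (l₀ : ℕ))) - (a k * w l₁ - h ((k : ℕ) + (l₁ : ℕ))) := by
      rw [hz, show (k' : ℕ) + (l₀ : ℕ) = (k : ℕ) + (l₁ : ℕ) by omega]
      field_simp
      ring
    have e2 : ‖a k' - z * a k‖ * ‖w l₀‖ ≤ 2 * δ := by
      rw [← norm_mul, e1]
      refine (norm_sub_le _ _).trans ?_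
      linarith [hδ k' l₀, hδ k l₁]
    calc ‖a k' - z * a k‖ ≤ ‖a k' - z * a k‖ * (κ * ‖w l₀‖) :=
          le_mul_of_one_le_right (norm_nonneg _) hκ
      _ = κ * (‖a k' - z * a k‖ * ‖w l₀‖) := by ring
      _ ≤ κ * (2 * δ) := mul_le_mul_of_nonneg_left e2 hκ0
      _ = _ := by ring
  have hstep : ∀ d, d + 3 ≤ M + N → ‖h (d + 1) - z * h d‖ ≤ (2 + 2 * κ) * δ := by
    intro d hd
    obtain ⟨k, k', l, hk, hkl⟩ : ∃ (k k' : Fin M) (l : Fin N),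
        (k' : ℕ) = k + 1 ∧ (k : ℕ) + (l : ℕ) = d := by
      by_cases hdM : d + 2 ≤ M
      · exact ⟨⟨d, by omega⟩, ⟨d + 1, by omega⟩, ⟨0, by have := l₀.2; omega⟩, rfl, rfl⟩
      · refine ⟨⟨M - 2, by omega⟩, ⟨M - 1, by omega⟩, ⟨d - (M - 2), by omega⟩, ?_, ?_⟩
        · simp only; omega
        · simp only; omega
    have e : h (d + 1) - z * h d = -(a k' * w l - h ((k' : ℕ) + (l : ℕ)))
        + (a k' - z * a k) * w l + z * (a k * w l - h ((k : ℕ) + (l : ℕ))) := by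
      rw [hkl, show (k' : ℕ) + (l : ℕ) = d + 1 by omega]
      ring
    have e1 : ‖(a k' - z * a k) * w l‖ ≤ 2 * κ * δ := by
      rw [norm_mul]
      exact (mul_le_of_le_one_right (norm_nonneg _) (hw l)).trans (ha k k' hk)
    have e2 : ‖z * (a k * w l - h ((k : ℕ) + (l : ℕ)))‖ ≤ δ := by
      rw [norm_mul]
      exact (mul_le_of_le_one_left (norm_nonneg _) hz1).trans (hδ k l)
    rw [e]
    refine (norm_add₃_le).trans ?_
    rw [norm_neg]
    linarith [hδ k' l]
  have hgeo : ∀ d : ℕ, d + 2 ≤ M + N → ‖h d - h 0 * z ^ d‖ ≤ d * ((2 + 2 * κ) * δ) := by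
    intro d
    induction d with
    | zero => intro _; simp
    | succ d ih =>
      intro hd
      have e : h (d + 1) - h 0 * z ^ (d + 1) = (h (d + 1) - z * h d)
          + z * (h d - h 0 * z ^ d) := by ring
      have e1 : ‖z * (h d - h 0 * z ^ d)‖ ≤ d * ((2 + 2 * κ) * δ) := by
        rw [norm_mul]
        exact (mul_le_of_le_one_left (norm_nonneg _) hz1).trans (ih (by omega))
      rw [e]
      refine (norm_add_le _ _).trans ?_
      push_cast
      linarith [hstep d (by omega)]
  refine ⟨z, fun k l => ?_⟩
  have e : a k * w l - h 0 * z ^ ((k : ℕ) + (l : ℕ)) = (a k * w l - h ((k : ℕ) + (l : ℕ)))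
      + (h ((k : ℕ) + (l : ℕ)) - h 0 * z ^ ((k : ℕ) + (l : ℕ))) := by ring
  have e1 : (((k : ℕ) + (l : ℕ) : ℕ) : ℝ) ≤ M + N := by
    have h1 := k.2
    have h2 := l.2
    exact_mod_cast (by omega : (k : ℕ) + (l : ℕ) ≤ M + N)
  have e2 := mul_le_mul_of_nonneg_right e1 (by positivity : 0 ≤ (2 + 2 * κ) * δ)
  rw [e]
  refine (norm_add_le _ _).trans ?_
  linarith [hδ k l, hgeo ((k : ℕ) + (l : ℕ)) (by omega)]

theorem norm_le_card_mul {x : EuclideanSpace ℂ (Fin M × Fin N)} {K : ℝ} (hx : ∀ p, ‖x p‖ ≤ K)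
    (hK : 0 ≤ K) : ‖x‖ ≤ (M * N : ℝ) * K := by
  have h1 : ‖x‖ ^ 2 ≤ (M * N : ℝ) * K ^ 2 := by
    rw [EuclideanSpace.norm_sq_eq]
    refine (Finset.sum_le_sum fun p _ => pow_le_pow_left₀ (norm_nonneg _) (hx p) 2).trans ?_
    simp
  rcases Nat.eq_zero_or_pos (M * N) with h0 | h0
  · have h0' : (M * N : ℝ) = 0 := by exact_mod_cast h0
    rw [h0', zero_mul] at h1 ⊢
    nlinarith [norm_nonneg x]
  · have h0' : (1 : ℝ) ≤ M * N := by exact_mod_cast h0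
    refine abs_le_of_sq_le_sq' ?_ (by positivity) |>.2
    nlinarith [mul_nonneg (mul_nonneg (by linarith : (0 : ℝ) ≤ M * N) (sq_nonneg K))
      (by linarith : (0 : ℝ) ≤ (M * N : ℝ) - 1)]

theorem exists_one_le_mul_norm {v : EuclideanSpace ℂ (Fin N)} (hv : ‖v‖ = 1) :
    ∃ l₀, (∀ l, ‖v l‖ ≤ ‖v l₀‖) ∧ 1 ≤ (N : ℝ) * ‖v l₀‖ := by
  have hne : Nonempty (Fin N) := by
    by_contra hne
    rw [not_nonempty_iff] at hne
    have : v = 0 := Subsingleton.elim _ _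
    simp [this] at hv
  obtain ⟨l₀, hl₀⟩ := Finite.exists_max fun l => ‖v l‖
  refine ⟨l₀, hl₀, ?_⟩
  have h1 : ‖v‖ ^ 2 ≤ ∑ _l : Fin N, ‖v l₀‖ := by
    rw [EuclideanSpace.norm_sq_eq]
    refine Finset.sum_le_sum fun l _ => ?_
    have h2 : ‖v l‖ ≤ 1 := hv ▸ PiLp.norm_apply_le v l
    nlinarith [norm_nonneg (v l), hl₀ l]
  simpa [hv] using h1

/-- Error bound: the distance of a rank-one matrix of norm one to the Hankel matrices of rank at
most one is controlled, uniformly, by its distance to the Hankel matrices. -/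
theorem exists_geometricHankel_near (hM : 2 ≤ M) (hN : 2 ≤ N) :
    ∃ C : ℝ, 1 ≤ C ∧ ∀ (u : EuclideanSpace ℂ (Fin M)) (v : EuclideanSpace ℂ (Fin N)),
      ‖u‖ = 1 → ‖v‖ = 1 → ∀ H : Matrix (Fin M) (Fin N) ℂ, IsHankel H →
      ∃ x ∈ geometricHankel M N,
        ‖entries (outer u v) - x‖ ≤ C * ‖entries (outer u v) - entries H‖ := by
  have hM' : (2 : ℝ) ≤ M := by exact_mod_cast hM
  have hN' : (2 : ℝ) ≤ N := by exact_mod_cast hN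
  refine ⟨(M * N : ℝ) * (1 + (M + N) * (2 + 2 * N)), ?_, ?_⟩
  · exact one_le_mul_of_one_le_of_one_le (by nlinarith) (le_add_of_nonneg_right (by positivity))
  intro u v hu hv H ⟨h, hh⟩
  set δ := ‖entries (outer u v) - entries H‖ with hδ
  have hent : ∀ k l, ‖u k * starRingEnd ℂ (v l) - h ((k : ℕ) + (l : ℕ))‖ ≤ δ := fun k l => by
    rw [← hh]
    exact PiLp.norm_apply_le (entries (outer u v) - entries H) (k, l)
  have hv1 : ∀ l, ‖starRingEnd ℂ (v l)‖ ≤ 1 := fun l => by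
    rw [RCLike.norm_conj]
    exact hv ▸ PiLp.norm_apply_le v l
  have hδ0 : 0 ≤ δ := norm_nonneg _
  obtain ⟨l₀, hmax, hl₀⟩ := exists_one_le_mul_norm hv
  -- A maximal entry of `v` that is not the last one is compared with its successor; otherwise the
  -- same is done after reversal of the order of the rows and of the columns.
  by_cases hlast : (l₀ : ℕ) + 1 < N
  · obtain ⟨z, hz⟩ := exists_geometric_approx hM hent hv1 (l₀ := l₀) (l₁ := ⟨l₀ + 1, hlast⟩)
      (κ := N) rfl (by simpa only [RCLike.norm_conj] using hmax _)
      (by simpa only [RCLike.norm_conj] using hl₀) (by positivity)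
    refine ⟨WithLp.toLp 2 fun p => h 0 * z ^ ((p.1 : ℕ) + (p.2 : ℕ)),
      ⟨h 0, z, Or.inl fun p => rfl⟩, ?_⟩
    rw [mul_assoc]
    exact norm_le_card_mul (fun p => hz p.1 p.2) (by positivity)
  · have hr : ∀ (k : Fin M) (l : Fin N), ‖u k.rev * starRingEnd ℂ (v l.rev)
        - (fun d => h (M + N - 2 - d)) ((k : ℕ) + (l : ℕ))‖ ≤ δ := fun k l => by
      have := hent k.rev l.rev
      rwa [show (k.rev : ℕ) + (l.rev : ℕ) = M + N - 2 - (k + l) by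
        rw [Fin.val_rev, Fin.val_rev]; omega] at this
    obtain ⟨z, hz⟩ := exists_geometric_approx hM (a := fun k => u k.rev)
      (w := fun l => starRingEnd ℂ (v l.rev)) (h := fun d => h (M + N - 2 - d)) (δ := δ) hr
      (fun l => hv1 l.rev)
      (l₀ := l₀.rev) (l₁ := ⟨(l₀.rev : ℕ) + 1, by rw [Fin.val_rev]; omega⟩) (κ := N) rfl
      (by simpa only [RCLike.norm_conj, Fin.rev_rev] using hmax _)
      (by simpa only [RCLike.norm_conj, Fin.rev_rev] using hl₀) (by positivity)
    refine ⟨WithLp.toLp 2 fun p => h (M + N - 2 - 0) * z ^ ((p.1.rev : ℕ) + (p.2.rev : ℕ)),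
      ⟨h (M + N - 2 - 0), z, Or.inr fun p => rfl⟩, ?_⟩
    rw [mul_assoc]
    refine norm_le_card_mul (fun p => ?_) (by positivity)
    have hp := hz p.1.rev p.2.rev
    simp only [Fin.rev_rev] at hp
    exact hp

/-- A geometric Hankel matrix of norm one has the normalized form. -/
theorem normal_form_of_mem_geometricHankel (hM : 2 ≤ M) (hN : 2 ≤ N)
    {H : Matrix (Fin M) (Fin N) ℂ} (hH : entries H ∈ geometricHankel M N) (h1 : ‖entries H‖ = 1) :
    ∃ c : ℂ, ‖c‖ = 1 ∧ ((∃ z : ℂ, H = c • Matrix.vecMulVec (zVec M z) (zVec N z)) ∨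
      H = c • Matrix.vecMulVec (eVec M) (eVec N)) := by
  have hgeo : ∀ c z : ℂ, (∀ k l, H k l = c * z ^ ((k : ℕ) + (l : ℕ))) →
      ∃ c : ℂ, ‖c‖ = 1 ∧ ∃ z : ℂ, H = c • Matrix.vecMulVec (zVec M z) (zVec N z) := by
    intro c z hc
    have hpos : ∀ n : ℕ, 2 ≤ n → 0 < ∑ i ∈ Finset.range n, ‖z‖ ^ (2 * i) := by
      intro n hn
      refine Finset.sum_pos' (fun i _ => by positivity) ⟨0, Finset.mem_range.2 (by omega), ?_⟩
      simp
    set sM := ∑ i ∈ Finset.range M, ‖z‖ ^ (2 * i) with hsM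
    set sN := ∑ i ∈ Finset.range N, ‖z‖ ^ (2 * i) with hsN
    have hpM := Real.sqrt_pos.2 (hpos M hM)
    have hpN := Real.sqrt_pos.2 (hpos N hN)
    refine ⟨c * (Real.sqrt sM : ℂ) * (Real.sqrt sN : ℂ), ?_, z, ?_⟩
    · have h2 : ‖c‖ ^ 2 * (sM * sN) = 1 := by
        have h3 : ‖entries H‖ ^ 2 = 1 := by rw [h1, one_pow]
        rw [EuclideanSpace.norm_sq_eq, Fintype.sum_prod_type] at h3
        rw [← h3, hsM, hsN, Finset.sum_range, Finset.sum_range, Finset.sum_mul_sum, Finset.mul_sum]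
        refine Finset.sum_congr rfl fun k _ => ?_
        rw [Finset.mul_sum]
        refine Finset.sum_congr rfl fun l _ => ?_
        rw [entries_apply, hc, norm_mul, norm_pow]
        ring
      rw [norm_mul, norm_mul, Complex.norm_real, Complex.norm_real, Real.norm_of_nonneg hpM.le,
        Real.norm_of_nonneg hpN.le]
      refine (sq_eq_sq₀ (by positivity) zero_le_one).1 ?_
      rw [mul_pow, mul_pow, Real.sq_sqrt (hpos M hM).le, Real.sq_sqrt (hpos N hN).le, one_pow, ← h2]
      ring
    · ext k l
      have e1 : (Real.sqrt sM : ℂ) ≠ 0 := by exact_mod_cast hpM.ne'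
      have e2 : (Real.sqrt sN : ℂ) ≠ 0 := by exact_mod_cast hpN.ne'
      simp only [hc, Matrix.smul_apply, Matrix.vecMulVec_apply, zVec, ← hsM, ← hsN, smul_eq_mul,
        Complex.ofReal_inv]
      field_simp
      ring
  obtain ⟨c, z, h | h⟩ := hH
  · obtain ⟨c', hc', hz⟩ := hgeo c z fun k l => h (k, l)
    exact ⟨c', hc', Or.inl hz⟩
  · by_cases hz : z = 0
    · have hHe : H = c • Matrix.vecMulVec (eVec M) (eVec N) := by
        ext k l
        have h2 := h (k, l)
        rw [entries_apply, hz] at h2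
        simp only [Matrix.smul_apply, Matrix.vecMulVec_apply, eVec, smul_eq_mul]
        rw [h2, Fin.val_rev, Fin.val_rev, zero_pow_eq]
        have hk := k.2
        have hl := l.2
        by_cases e1 : (k : ℕ) + 1 = M
        · by_cases e2 : (l : ℕ) + 1 = N
          · simp [e1, e2]
          · simp [e1, e2, show N - ((l : ℕ) + 1) ≠ 0 by omega]
        · simp [e1, show M - ((k : ℕ) + 1) ≠ 0 by omega]
      refine ⟨c, ?_, Or.inr hHe⟩
      have h3 : ‖entries H‖ ^ 2 = 1 := by rw [h1, one_pow]
      rw [EuclideanSpace.norm_sq_eq,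
        Finset.sum_eq_single ((⟨M - 1, by omega⟩, ⟨N - 1, by omega⟩) : Fin M × Fin N)] at h3
      · rw [h, Fin.val_rev, Fin.val_rev] at h3
        have e : M - (M - 1 + 1) + (N - (N - 1 + 1)) = 0 := by omega
        simp only [e, pow_zero, mul_one] at h3
        exact (sq_eq_sq₀ (norm_nonneg _) zero_le_one).1 (by rw [h3, one_pow])
      · intro p _ hp
        rw [h, hz, zero_pow, mul_zero, norm_zero, zero_pow two_ne_zero]
        intro h0
        apply hp
        rw [Fin.val_rev, Fin.val_rev] at h0
        ext
        · have := p.1.2; simp only; omega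
        · have := p.2.2; simp only; omega
      · simp
    · obtain ⟨c', hc', hz'⟩ := hgeo (c * z ^ (M + N - 2)) z⁻¹ fun k l => by
        have h2 := h (k, l)
        rw [entries_apply] at h2
        rw [h2, Fin.val_rev, Fin.val_rev, mul_assoc, inv_pow, ← div_eq_mul_inv]
        congr 1
        rw [eq_div_iff (pow_ne_zero _ hz), ← pow_add]
        congr 1
        simp only
        omega
      exact ⟨c', hc', Or.inl hz'⟩

/-! ### Limits of sequences of matrices -/

/-- If the distances to a set decrease geometrically from some point on, and each step is bounded
by a multiple of the distance to the set, then the sequence converges. -/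
theorem exists_tendsto_of_infDist {E : Type*} [MetricSpace E] [CompleteSpace E] {S : Set E}
    {x : ℕ → E} {r K : ℝ} (hr0 : 0 ≤ r) (hr1 : r < 1) (hK : 0 ≤ K)
    (hd : ∀ᶠ j in atTop, Metric.infDist (x (j + 1)) S ≤ r * Metric.infDist (x j) S)
    (hx : ∀ᶠ j in atTop, dist (x j) (x (j + 1)) ≤ K * Metric.infDist (x j) S) :
    ∃ y, Tendsto x atTop (𝓝 y) := by
  obtain ⟨J, hJ⟩ := eventually_atTop.1 (hd.and hx)
  have hgeo : ∀ n, Metric.infDist (x (n + J)) S ≤ Metric.infDist (x J) S * r ^ n := by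
    intro n
    induction n with
    | zero => simp
    | succ n ih =>
      have h1 := (hJ (n + J) (by omega)).1
      rw [show n + 1 + J = n + J + 1 by omega, pow_succ]
      nlinarith [mul_le_mul_of_nonneg_left ih hr0]
  have hc : CauchySeq fun n => x (n + J) := by
    refine cauchySeq_of_le_geometric r (K * Metric.infDist (x J) S) hr1 fun n => ?_
    have h1 := (hJ (n + J) (by omega)).2
    rw [show n + 1 + J = n + J + 1 by omega, mul_assoc]
    exact h1.trans (mul_le_mul_of_nonneg_left (hgeo n) hK)
  obtain ⟨y, hy⟩ := cauchySeq_tendsto_of_complete hc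
  exact ⟨y, (tendsto_add_atTop_iff_nat J).1 hy⟩

theorem tendsto_of_tendsto_entries {ι : Type*} {l : Filter ι} {f : ι → Matrix (Fin M) (Fin N) ℂ}
    {H : Matrix (Fin M) (Fin N) ℂ} (h : Tendsto (fun j => entries (f j)) l (𝓝 (entries H))) :
    Tendsto f l (𝓝 H) := by
  refine tendsto_pi_nhds.2 fun k => tendsto_pi_nhds.2 fun m => ?_
  exact ((PiLp.continuous_apply 2 (fun _ : Fin M × Fin N => ℂ) (k, m)).tendsto _).comp h

theorem exists_entries_eq (x : EuclideanSpace ℂ (Fin M × Fin N)) : ∃ H, entries H = x :=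
  ⟨Matrix.of fun k l => x (k, l), rfl⟩

theorem isHankel_of_tendsto {ι : Type*} {l : Filter ι} [l.NeBot]
    {f : ι → Matrix (Fin M) (Fin N) ℂ} {H : Matrix (Fin M) (Fin N) ℂ}
    (hf : ∀ j, IsHankel (f j)) (h : Tendsto (fun j => entries (f j)) l (𝓝 (entries H))) :
    IsHankel H := by
  have hent := fun p : Fin M × Fin N =>
    ((PiLp.continuous_apply 2 (fun _ : Fin M × Fin N => ℂ) p).tendsto _).comp h
  have heq : ∀ p q : Fin M × Fin N, (p.1 : ℕ) + p.2 = (q.1 : ℕ) + q.2 → H p.1 p.2 = H q.1 q.2 := by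
    intro p q hpq
    refine tendsto_nhds_unique (hent p) ((hent q).congr fun j => ?_)
    obtain ⟨g, hg⟩ := hf j
    simp only [Function.comp_apply, entries_apply, hg, hpq]
  exact ⟨Function.extend (fun p : Fin M × Fin N => (p.1 : ℕ) + p.2) (fun p => H p.1 p.2) 0,
    fun k m => (Function.FactorsThrough.extend_apply (fun p q hpq => heq p q hpq) 0 (k, m)).symm⟩

theorem IsHankel.smul {H : Matrix (Fin M) (Fin N) ℂ} (hH : IsHankel H) (t : ℂ) :
    IsHankel (t • H) := by
  obtain ⟨h, hh⟩ := hH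
  exact ⟨fun d => t * h d, fun k l => by rw [Matrix.smul_apply, hh, smul_eq_mul]⟩

theorem isHankel_zero : IsHankel (0 : Matrix (Fin M) (Fin N) ℂ) := ⟨0, fun _ _ => rfl⟩

/-! ### Contraction along the iteration -/

namespace IsCadzowIteration

variable {A : Matrix (Fin M) (Fin N) ℂ} {σ : ℕ → ℝ} {u : ℕ → EuclideanSpace ℂ (Fin M)}
  {v : ℕ → EuclideanSpace ℂ (Fin N)}

theorem exists_isLeadingSingularTriple (hC : IsCadzowIteration A σ u v) (j : ℕ) :
    ∃ B, IsLeadingSingularTriple B (σ j) (u j) (v j) := by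
  cases j with
  | zero => exact ⟨_, hC.start⟩
  | succ j => exact ⟨_, hC.step j⟩

theorem norm_entries (hC : IsCadzowIteration A σ u v) (j : ℕ) :
    ‖entries ((σ j : ℂ) • outer (u j) (v j))‖ = σ j := by
  obtain ⟨B, hB⟩ := hC.exists_isLeadingSingularTriple j
  exact hB.norm_entries_smul_outer

theorem nonneg (hC : IsCadzowIteration A σ u v) (j : ℕ) : 0 ≤ σ j :=
  hC.norm_entries j ▸ norm_nonneg _

/-- The squared Frobenius norm is lost exactly in the projection onto the Hankel matrices and in
the truncation of the singular value decomposition. -/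
theorem sq_eq (hC : IsCadzowIteration A σ u v) (j : ℕ) :
    σ j ^ 2 = σ (j + 1) ^ 2
      + ‖entries ((σ j : ℂ) • outer (u j) (v j))
        - entries (hankelProj ((σ j : ℂ) • outer (u j) (v j)))‖ ^ 2
      + ‖entries (hankelProj ((σ j : ℂ) • outer (u j) (v j)))
        - entries ((σ (j + 1) : ℂ) • outer (u (j + 1)) (v (j + 1)))‖ ^ 2 := by
  have h1 := norm_sub_sq_of_isHankel isHankel_zero ((σ j : ℂ) • outer (u j) (v j))
  rw [map_zero, sub_zero, sub_zero, hC.norm_entries] at h1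
  have h2 := (hC.step j).norm_entries_sq
  linarith

theorem antitone (hC : IsCadzowIteration A σ u v) : Antitone σ := by
  refine antitone_nat_of_succ_le fun j => ?_
  refine (sq_le_sq₀ (hC.nonneg _) (hC.nonneg _)).1 ?_
  have h := hC.sq_eq j
  linarith [sq_nonneg ‖entries ((σ j : ℂ) • outer (u j) (v j))
      - entries (hankelProj ((σ j : ℂ) • outer (u j) (v j)))‖,
    sq_nonneg ‖entries (hankelProj ((σ j : ℂ) • outer (u j) (v j)))
        - entries ((σ (j + 1) : ℂ) • outer (u (j + 1)) (v (j + 1)))‖]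

theorem tendsto_losses (hC : IsCadzowIteration A σ u v) {s : ℝ} (hσ : Tendsto σ atTop (𝓝 s)) :
    Tendsto (fun j => ‖entries ((σ j : ℂ) • outer (u j) (v j))
        - entries (hankelProj ((σ j : ℂ) • outer (u j) (v j)))‖) atTop (𝓝 0) ∧
    Tendsto (fun j => ‖entries (hankelProj ((σ j : ℂ) • outer (u j) (v j)))
        - entries ((σ (j + 1) : ℂ) • outer (u (j + 1)) (v (j + 1)))‖) atTop (𝓝 0) := by
  have h0 : Tendsto (fun j => σ j ^ 2 - σ (j + 1) ^ 2) atTop (𝓝 0) := by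
    simpa using (hσ.pow 2).sub (((tendsto_add_atTop_iff_nat 1).2 hσ).pow 2)
  have h1 : Tendsto (fun j => Real.sqrt (σ j ^ 2 - σ (j + 1) ^ 2)) atTop (𝓝 0) := by
    simpa only [Real.sqrt_zero, Function.comp_def] using (Real.continuous_sqrt.tendsto 0).comp h0
  constructor
  all_goals
    refine squeeze_zero (fun _ => norm_nonneg _) (fun j => Real.le_sqrt_of_sq_le ?_) h1
    have h := hC.sq_eq j
    nlinarith [sq_nonneg ‖entries ((σ j : ℂ) • outer (u j) (v j))
        - entries (hankelProj ((σ j : ℂ) • outer (u j) (v j)))‖,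
      sq_nonneg ‖entries (hankelProj ((σ j : ℂ) • outer (u j) (v j)))
          - entries ((σ (j + 1) : ℂ) • outer (u (j + 1)) (v (j + 1)))‖]

/-- The error bound for a member of the sequence, not normalized. -/
theorem infDist_le {C : ℝ} (hC : IsCadzowIteration A σ u v)
    (hbound : ∀ (u : EuclideanSpace ℂ (Fin M)) (v : EuclideanSpace ℂ (Fin N)),
      ‖u‖ = 1 → ‖v‖ = 1 → ∀ H : Matrix (Fin M) (Fin N) ℂ, IsHankel H →
      ∃ x ∈ geometricHankel M N,
        ‖entries (outer u v) - x‖ ≤ C * ‖entries (outer u v) - entries H‖)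
    {j : ℕ} (hj : 0 < σ j) :
    Metric.infDist (entries ((σ j : ℂ) • outer (u j) (v j))) (geometricHankel M N) ≤
      C * ‖entries ((σ j : ℂ) • outer (u j) (v j))
        - entries (hankelProj ((σ j : ℂ) • outer (u j) (v j)))‖ := by
  obtain ⟨B, hB⟩ := hC.exists_isLeadingSingularTriple j
  have hσ0 : (σ j : ℂ) ≠ 0 := by exact_mod_cast hj.ne'
  set Y := hankelProj ((σ j : ℂ) • outer (u j) (v j)) with hY
  obtain ⟨x, hx, hxle⟩ := hbound (u j) (v j) hB.norm_left hB.norm_right ((σ j : ℂ)⁻¹ • Y)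
    ((hankelProj_isHankel _).smul _)
  refine (Metric.infDist_le_dist_of_mem (smul_mem_geometricHankel hx (σ j : ℂ))).trans ?_
  have e1 : entries Y = (σ j : ℂ) • entries ((σ j : ℂ)⁻¹ • Y) := by
    rw [map_smul, smul_inv_smul₀ hσ0]
  rw [dist_eq_norm, e1, map_smul, ← smul_sub, ← smul_sub, norm_smul, norm_smul, mul_left_comm]
  exact mul_le_mul_of_nonneg_left hxle (norm_nonneg _)

/-- Near the limit of the singular values one step of the iteration is a contraction towards the
Hankel matrices of rank at most one. The projection onto the Hankel matrices gains a fixed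
proportion of the squared distance by the error bound, and the truncation to rank one loses only an
arbitrarily small proportion of it. -/
theorem exists_tendsto_entries (hM : 2 ≤ M) (hN : 2 ≤ N) (hC : IsCadzowIteration A σ u v) {s : ℝ}
    (hσ : Tendsto σ atTop (𝓝 s)) (hs : 0 < s) :
    ∃ x, Tendsto (fun j => entries ((σ j : ℂ) • outer (u j) (v j))) atTop (𝓝 x) := by
  obtain ⟨C, hC1, hbound⟩ := exists_geometricHankel_near hM hN
  have hsσ : ∀ j, s ≤ σ j := hC.antitone.le_of_tendsto hσ
  set X := fun j => entries ((σ j : ℂ) • outer (u j) (v j)) with hX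
  set Y := fun j => entries (hankelProj ((σ j : ℂ) • outer (u j) (v j))) with hY
  set S := geometricHankel M N with hS
  have hne : S.Nonempty := ⟨0, zero_mem_geometricHankel⟩
  set t := 1 / C ^ 2 with ht
  have ht0 : 0 < t := by positivity
  have ht1 : t ≤ 1 := by
    rw [ht, div_le_one (by positivity)]
    exact one_le_pow₀ hC1
  have hε : ∀ᶠ j in atTop, 4 * ‖Y j - X (j + 1)‖ / σ (j + 1) ≤ t / 4 := by
    have h1 := (hC.tendsto_losses hσ).2.eventually_le_const (show 0 < s * (t / 16) by positivity)
    filter_upwards [h1] with j hj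
    rw [div_le_iff₀ (hs.trans_le (hsσ _))]
    have h2 := mul_le_mul_of_nonneg_right (hsσ (j + 1)) (by positivity : 0 ≤ t / 16)
    simp only [hX, hY]
    linarith
  -- Quasi-Fejér monotonicity: the gain from the projection, up to the cost of the truncation.
  have hfejer : ∀ᶠ j in atTop, ∀ x ∈ S,
      (1 - t / 4) * dist (X (j + 1)) x ^ 2 + ‖X j - Y j‖ ^ 2 ≤ dist (X j) x ^ 2 := by
    filter_upwards [hε] with j hj x hx
    obtain ⟨a, b, rfl, hH⟩ := exists_outer_of_mem_geometricHankel hx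
    have h1 := (hC.step j).norm_smul_outer_sub_sq_le (hs.trans_le (hsσ _)) a b
    have h2 := norm_sub_sq_of_isHankel hH ((σ j : ℂ) • outer (u j) (v j))
    have h3 : (1 - t / 4) * ‖X (j + 1) - entries (outer a b)‖ ^ 2
        ≤ (1 - 4 * ‖Y j - X (j + 1)‖ / σ (j + 1)) * ‖X (j + 1) - entries (outer a b)‖ ^ 2 :=
      mul_le_mul_of_nonneg_right (by linarith) (sq_nonneg _)
    rw [dist_eq_norm, dist_eq_norm]
    simp only [hX, hY] at h3 ⊢
    linarith
  -- The rate `1 - t / 2` for the squared distances works since `1 - t ≤ (1 - t / 4) (1 - t / 2)`.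
  have hr0 : 0 ≤ 1 - t / 2 := by linarith
  refine exists_tendsto_of_infDist (S := S) (r := Real.sqrt (1 - t / 2)) (K := 3)
    (Real.sqrt_nonneg _) ?_ (by norm_num) ?_ ?_
  · rw [Real.sqrt_lt' one_pos]
    linarith
  · filter_upwards [hfejer] with j hj
    set d := Metric.infDist (X j) S
    set d' := Metric.infDist (X (j + 1)) S
    have hd0 : 0 ≤ d := Metric.infDist_nonneg
    have hd'0 : 0 ≤ d' := Metric.infDist_nonneg
    have h1 : (1 - t / 4) * d' ^ 2 + ‖X j - Y j‖ ^ 2 ≤ d ^ 2 := by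
      refine (Real.sqrt_le_left hd0).1 ((Metric.le_infDist hne).2 fun x hx => ?_)
      refine (Real.sqrt_le_left dist_nonneg).2 (le_trans ?_ (hj x hx))
      have h2 : d' ^ 2 ≤ dist (X (j + 1)) x ^ 2 :=
        pow_le_pow_left₀ hd'0 (Metric.infDist_le_dist_of_mem hx) 2
      have h3 := mul_le_mul_of_nonneg_left h2 (by linarith : 0 ≤ 1 - t / 4)
      linarith
    have h2 : t * d ^ 2 ≤ ‖X j - Y j‖ ^ 2 := by
      have h3 := pow_le_pow_left₀ hd0 (hC.infDist_le hbound (hs.trans_le (hsσ j))) 2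
      rw [mul_pow] at h3
      rw [ht, div_mul_eq_mul_div, one_mul, div_le_iff₀ (by positivity), mul_comm]
      exact h3
    have h3 : (1 - t / 4) * d' ^ 2 ≤ (1 - t / 4) * ((1 - t / 2) * d ^ 2) := by
      have h4 : (1 - t / 4) * ((1 - t / 2) * d ^ 2)
          = d ^ 2 - t * d ^ 2 + (t / 4 + t ^ 2 / 8) * d ^ 2 := by ring
      have h5 : 0 ≤ (t / 4 + t ^ 2 / 8) * d ^ 2 := by positivity
      linarith
    have h4 := le_of_mul_le_mul_left h3 (by linarith)
    refine (sq_le_sq₀ hd'0 (by positivity)).1 ?_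
    rwa [mul_pow, Real.sq_sqrt hr0]
  · filter_upwards [hfejer] with j hj
    rw [← div_le_iff₀' (by norm_num : (0 : ℝ) < 3)]
    refine (Metric.le_infDist hne).2 fun x hx => ?_
    have h1 : dist (X (j + 1)) x ≤ 2 * dist (X j) x := by
      refine (sq_le_sq₀ dist_nonneg (by positivity)).1 ?_
      have h2 := mul_le_mul_of_nonneg_right (by linarith : 3 / 4 ≤ 1 - t / 4)
        (sq_nonneg (dist (X (j + 1)) x))
      linarith [hj x hx, sq_nonneg ‖X j - Y j‖, sq_nonneg (dist (X j) x),
        mul_pow 2 (dist (X j) x) 2]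
    rw [div_le_iff₀' (by norm_num)]
    linarith [dist_triangle_right (X j) (X (j + 1)) x]

end IsCadzowIteration

/-! ### The limit -/

theorem tendsto_outer {ι : Type*} {l : Filter ι} {u : ι → EuclideanSpace ℂ (Fin M)}
    {v : ι → EuclideanSpace ℂ (Fin N)} {a : EuclideanSpace ℂ (Fin M)} {b : EuclideanSpace ℂ (Fin N)}
    (hu : Tendsto u l (𝓝 a)) (hv : Tendsto v l (𝓝 b)) :
    Tendsto (fun j => outer (u j) (v j)) l (𝓝 (outer a b)) := by
  refine tendsto_pi_nhds.2 fun k => tendsto_pi_nhds.2 fun m => ?_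
  have h1 : Tendsto (fun j => u j k) l (𝓝 (a k)) :=
    ((PiLp.continuous_apply 2 (fun _ : Fin M => ℂ) k).tendsto a).comp hu
  have h2 : Tendsto (fun j => v j m) l (𝓝 (b m)) :=
    ((PiLp.continuous_apply 2 (fun _ : Fin N => ℂ) m).tendsto b).comp hv
  exact h1.mul ((Complex.continuous_conj.tendsto (b m)).comp h2)

/-- By compactness of the unit spheres, limits of unit matrices of rank one are again of this
kind. -/
theorem exists_outer_of_tendsto {u : ℕ → EuclideanSpace ℂ (Fin M)}
    {v : ℕ → EuclideanSpace ℂ (Fin N)} (hu : ∀ j, ‖u j‖ = 1) (hv : ∀ j, ‖v j‖ = 1)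
    {H : Matrix (Fin M) (Fin N) ℂ} (h : Tendsto (fun j => outer (u j) (v j)) atTop (𝓝 H)) :
    ∃ a b, ‖a‖ = 1 ∧ ‖b‖ = 1 ∧ H = outer a b := by
  obtain ⟨a, ha, φ, hφ, hlim⟩ := (isCompact_sphere (0 : EuclideanSpace ℂ (Fin M)) 1).tendsto_subseq
    (x := u) fun j => by rw [mem_sphere_zero_iff_norm, hu]
  obtain ⟨b, hb, ψ, hψ, hlim'⟩ :=
    (isCompact_sphere (0 : EuclideanSpace ℂ (Fin N)) 1).tendsto_subseq
    (x := v ∘ φ) fun j => by rw [mem_sphere_zero_iff_norm, Function.comp_apply, hv]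
  have h2 : Tendsto (fun j => outer (u (φ (ψ j))) (v (φ (ψ j)))) atTop (𝓝 (outer a b)) :=
    tendsto_outer (hlim.comp hψ.tendsto_atTop) hlim'
  have h3 : Tendsto (fun j => outer (u (φ (ψ j))) (v (φ (ψ j)))) atTop (𝓝 H) :=
    h.comp (hφ.tendsto_atTop.comp hψ.tendsto_atTop)
  have ha' : ‖a‖ = 1 := mem_sphere_zero_iff_norm.1 ha
  have hb' : ‖b‖ = 1 := mem_sphere_zero_iff_norm.1 hb
  have h4 : H = outer a b := tendsto_nhds_unique h3 h2
  exact ⟨a, b, ha', hb', h4⟩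

end Cadzow

open Cadzow

theorem mainTheorem5 {M N : ℕ} (hM : 2 ≤ M) (hMN : M ≤ N)
    (A : Matrix (Fin M) (Fin N) ℂ) (hA : 1 ≤ A.rank)
    (σ : ℕ → ℝ) (u : ℕ → EuclideanSpace ℂ (Fin M)) (v : ℕ → EuclideanSpace ℂ (Fin N))
    (hC : Cadzow.IsCadzowIteration A σ u v) :
    ∃ s : ℝ, Tendsto σ atTop (𝓝 s) ∧ 0 ≤ s ∧
      (s = 0 → Tendsto (fun j => (σ j : ℂ) • Cadzow.outer (u j) (v j)) atTop (𝓝 0)) ∧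
      (0 < s → ∃ H : Matrix (Fin M) (Fin N) ℂ,
        Tendsto (fun j => Cadzow.outer (u j) (v j)) atTop (𝓝 H) ∧
        (∃ c : ℂ, ‖c‖ = 1 ∧
          ((∃ z : ℂ, H = c • Matrix.vecMulVec (Cadzow.zVec M z) (Cadzow.zVec N z)) ∨
            H = c • Matrix.vecMulVec (Cadzow.eVec M) (Cadzow.eVec N))) ∧
        Tendsto (fun j => (σ j : ℂ) • Cadzow.outer (u j) (v j)) atTop (𝓝 ((s : ℂ) • H)) ∧
        Cadzow.IsHankel ((s : ℂ) • H) ∧ ((s : ℂ) • H).rank = 1) := by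
  have hbdd : BddBelow (Set.range σ) := ⟨0, by rintro _ ⟨j, rfl⟩; exact hC.nonneg j⟩
  have hσ : Tendsto σ atTop (𝓝 (⨅ j, σ j)) := tendsto_atTop_ciInf hC.antitone hbdd
  refine ⟨_, hσ, Real.iInf_nonneg hC.nonneg, fun h0 => ?_, fun hs => ?_⟩
  · refine tendsto_of_tendsto_entries ?_
    rw [map_zero, tendsto_zero_iff_norm_tendsto_zero]
    simpa only [hC.norm_entries, h0] using hσ
  have hN : 2 ≤ N := hM.trans hMN
  obtain ⟨x, hx⟩ := hC.exists_tendsto_entries hM hN hσ hs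
  set s := ⨅ j, σ j
  have hs0 : (s : ℂ) ≠ 0 := by exact_mod_cast hs.ne'
  have hσ0 : ∀ j, (σ j : ℂ) ≠ 0 := fun j => by
    exact_mod_cast (hs.trans_le (ciInf_le hbdd j)).ne'
  obtain ⟨H, hH⟩ := exists_entries_eq ((s : ℂ)⁻¹ • x)
  have hxH : x = entries ((s : ℂ) • H) := by rw [map_smul, hH, smul_inv_smul₀ hs0]
  have hσc : Tendsto (fun j => (σ j : ℂ)) atTop (𝓝 (s : ℂ)) :=
    (Complex.continuous_ofReal.tendsto s).comp hσ
  have hG : Tendsto (fun j => entries (outer (u j) (v j))) atTop (𝓝 (entries H)) := by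
    rw [hH]
    refine ((hσc.inv₀ hs0).smul hx).congr fun j => ?_
    rw [map_smul, inv_smul_smul₀ (hσ0 j)]
  have hsH : IsHankel ((s : ℂ) • H) := by
    refine isHankel_of_tendsto (l := atTop)
      (fun j => hankelProj_isHankel ((σ j : ℂ) • outer (u j) (v j))) ?_
    have h1 := hx.sub (tendsto_zero_iff_norm_tendsto_zero.2 (hC.tendsto_losses hσ).1)
    simpa only [sub_sub_cancel, sub_zero, hxH] using h1
  have hHH : IsHankel H := by
    have h1 := hsH.smul (s : ℂ)⁻¹
    rwa [inv_smul_smul₀ hs0] at h1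
  have hunit : ∀ j, ‖u j‖ = 1 ∧ ‖v j‖ = 1 := fun j => by
    obtain ⟨B, hB⟩ := hC.exists_isLeadingSingularTriple j
    exact ⟨hB.norm_left, hB.norm_right⟩
  obtain ⟨a, b, ha, hb, hab⟩ := exists_outer_of_tendsto (fun j => (hunit j).1)
    (fun j => (hunit j).2) (tendsto_of_tendsto_entries hG)
  have hH1 : ‖entries H‖ = 1 := by rw [hab, norm_entries_outer, ha, hb, mul_one]
  -- The limit is a Hankel matrix of rank one, so the error bound puts it at distance zero.
  have hmem : entries H ∈ geometricHankel M N := by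
    obtain ⟨C, -, hbound⟩ := exists_geometricHankel_near hM hN
    obtain ⟨y, hy, hle⟩ := hbound a b ha hb H hHH
    rw [← hab, sub_self, norm_zero, mul_zero] at hle
    rwa [sub_eq_zero.1 (norm_le_zero_iff.1 hle)]
  have hsH0 : (s : ℂ) • H ≠ 0 := smul_ne_zero hs0 fun h0 => by simp [h0] at hH1
  refine ⟨H, tendsto_of_tendsto_entries hG, normal_form_of_mem_geometricHankel hM hN hmem hH1,
    tendsto_of_tendsto_entries (hxH ▸ hx), hsH, le_antisymm ?_ ?_⟩
  · have h1 : (s : ℂ) • H = Matrix.vecMulVec ((s : ℂ) • a.ofLp) (star b.ofLp) := by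
      ext k l
      simp [hab, outer, Matrix.vecMulVec_apply, mul_assoc]
    rw [h1]
    exact Matrix.rank_vecMulVec_le _ _
  · rw [Nat.one_le_iff_ne_zero]
    intro h0
    have h1 := Submodule.finrank_eq_zero.1 h0
    rw [LinearMap.range_eq_bot] at h1
    refine hsH0 (Matrix.mulVec_injective (funext fun w => ?_))
    rw [Matrix.zero_mulVec]
    exact LinearMap.congr_fun h1 w
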